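/- Let $n,k,r$ be integers and $\alpha_k$ a real number with $\sqrt n/10^4\ge k\ge r\ge\alpha_k\ge 1$, and let $\varepsilon\in(0,1)$ satisfy $240\,k!/n^r\le\varepsilon$. For $p,q\in[0,1]$ define a pair $(G_1,G_2)$ of correlated random $k$-uniform hypergraphs on the vertex set $[n]$ as follows. $G_1$ is Erdős–Rényi: every $k$-element subset of $[n]$ is an edge independently with probability $p$. Independently of $G_1$, let $\mathcal R$ be a random set of $r$-element subsets of $[n]$ (the roots), each being included independently with probability $q$; $G_2$ is obtained from $G_1$ by adding as edges all $k$-element subsets of $[n]$ that contain at least one root. Write $e(G)$ for the number of edges of $G$. A deterministic independence-oracle algorithm $A$ for $n$-vertex $k$-hypergraphs is a deterministic adaptive decision tree (which may depend on $n$ and $k$) that repeatedly queries sets $S\subseteq[n]$, is told whether $G[S]$ contains no edge (answer $1$) or some edge (answer $0$), chooses its next query depending on the answers so far, and after finitely many queries halts with an output $A(G)$. A query to $S$ costs $|S|^{\alpha_k}$ (and $0$ if $S=\emptyset$), and $\mathrm{cost}(A,G)$ is the sum of the costs of the queries that $A$ makes on $G$. Then there are $p,q\in[0,1]$ (which may depend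 on $n,k,r,\alpha_k,\varepsilon$) such that the pair $(G_1,G_2)$ has the following properties: (i) $\Pr\big[e(G_2)>(1+\varepsilon)\,e(G_1)\big]\ge 0.95$. (ii) Every deterministic independence-oracle algorithm $A$ with $\Pr\big[A(G_1)\ne A(G_2)\big]\ge 2/3$ satisfies $$\mathbb E\big[\mathrm{cost}(A,G_1)\big]\;\ge\;\frac{n^{\,r(k-r+\alpha_k)/k}}{1080\,k^{3k}\,\varepsilon^{(r-\alpha_k)/k}}.$$ -/

import Mathlib

open MeasureTheory ProbabilityTheory
open scoped Nat

/-- A `k`-uniform hypergraph on the vertex set `Fin n`, given by its set of edges; an edge is an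
element of `Set.powersetCard (Fin n) k`, that is, a set of exactly `k` vertices. -/
abbrev UniformHypergraph (n k : ℕ) : Type := Set (Set.powersetCard (Fin n) k)

namespace UniformHypergraph

/-- The number `e(G)` of edges. -/
noncomputable def edgeCount {n k : ℕ} (G : UniformHypergraph n k) : ℕ := Set.ncard G

open Classical in
/-- The independence oracle of `G`: the answer to a query `S` is `true` (the bit `1`) if the induced
subgraph `G[S]` has no edge, and `false` (the bit `0`) otherwise. -/
noncomputable def indOracle {n k : ℕ} (G : UniformHypergraph n k) (S : Finset (Fin n)) : Bool :=
  decide (∀ e ∈ G, ¬ (e : Finset (Fin n)) ⊆ S)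

/-- The `k`-hypergraph of all size-`k` vertex sets that contain at least one of the given size-`r`
sets (the roots). -/
def ofRoots {n r : ℕ} (k : ℕ) (R : Set (Set.powersetCard (Fin n) r)) : UniformHypergraph n k :=
  {e | ∃ X ∈ R, (X : Finset (Fin n)) ⊆ (e : Finset (Fin n))}

/-- The Erdős–Rényi `k`-hypergraph on `Fin n`: every size-`k` set is an edge independently with
probability `p`. -/
noncomputable def erdosRenyi (n k : ℕ) (p : unitInterval) : Measure (UniformHypergraph n k) :=
  setBernoulli Set.univ p

/-- The joint law of a pair `(G₁, G₂)` of correlated random `k`-hypergraphs: `G₁` is Erdős–Rényi with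
edge probability `p`, and `G₂` is obtained from `G₁` by adding all size-`k` sets that contain a root,
where, independently of `G₁`, every size-`r` set is a root independently with probability `q`. -/
noncomputable def rootedPair (n k r : ℕ) (p q : unitInterval) :
    Measure (UniformHypergraph n k × UniformHypergraph n k) :=
  ((erdosRenyi n k p).prod
    (setBernoulli (Set.univ : Set (Set.powersetCard (Fin n) r)) q)).map
      (fun x => (x.1, x.1 ∪ ofRoots k x.2))

end UniformHypergraph

/-- A deterministic oracle algorithm on the vertex set `V` with outputs in `β`, as a decision tree:
it either halts with an output, or queries a set `S` of vertices and continues in a way that depends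
on the bit which the oracle returns. The parameters `n` and `k` are known to the algorithm, since it
may be chosen after them. Only oracle queries are charged, so the computation between two queries is
not restricted. -/
inductive OracleAlgorithm (V : Type) (β : Type*) where
  | output (b : β) : OracleAlgorithm V β
  | query (S : Finset V) (next : Bool → OracleAlgorithm V β) : OracleAlgorithm V β

namespace OracleAlgorithm

variable {V : Type} {β : Type*}

/-- The output `A(O)` of the algorithm `A` on the oracle `O`. -/
def run (O : Finset V → Bool) : OracleAlgorithm V β → β
  | output b => b
  | query S next => run O (next (O S))

/-- The sequence of queries that the algorithm makes on the oracle `O`. -/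
def queries (O : Finset V → Bool) : OracleAlgorithm V β → List (Finset V)
  | output _ => []
  | query S next => S :: queries O (next (O S))

/-- The total oracle cost on the oracle `O`, when a query to a set of size `m` costs `cost m`. -/
noncomputable def oracleCost (cost : ℕ → ℝ) (A : OracleAlgorithm V β) (O : Finset V → Bool) : ℝ :=
  ((A.queries O).map (fun S => cost S.card)).sum

end OracleAlgorithm

/-- The cost function `m ↦ m ^ α` on query sizes; the empty query costs nothing. -/
noncomputable def powerCost (α : ℝ) (m : ℕ) : ℝ := if m = 0 then 0 else (m : ℝ) ^ α

/-!
The edge probability `p` is chosen so that `ε * e(G₁)` has expectation `1 / 100` of the number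
`(n - r).choose (k - r)` of size-`k` sets that contain a given root, and the root probability `q` so
that four roots are expected.

Edge counts. There is a root except with probability about `e⁻⁴`. Given a root, `G₂` can have at
most `(1 + ε) * e(G₁)` edges only if `ε * e(G₁)`, together with the number of edges of `G₁` that
contain this root, reaches `(n - r).choose (k - r)`; Markov's inequality makes this unlikely
(`UniformHypergraph.rootedPair_real_edgeCount_le`).

Oracle cost. Let the `r`-shadow of a `k`-hypergraph be the set of all size-`r` subsets of its edges.
To tell `G₂` from `G₁`, the algorithm has to query an independent set of `G₁` that contains a
size-`k` superset of a root, so a root has to lie in the shadow of the set of non-edges of `G₁` that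
the algorithm gets to know (`OracleAlgorithm.exists_root_of_run_ne`). Since roots are independent of
`G₁`, the probability of this is at most `q` times the expected size of that shadow
(`UniformHypergraph.real_run_ne_le`). The shadow grows slowly for the following reason. Suppose that
`F` is the set of known non-edges and that `S` is queried. If the query would add `N` sets to the
shadow, then all size-`k` sets between such a set and `S` are outside `F`, so double counting gives
many size-`k` subsets of `S` outside `F`, say `M` of them
(`UniformHypergraph.ncard_shadow_sdiff_mul_le`). The information available so far consists of `F`
being free of edges and of an increasing event, so, by a form of Harris' inequality
(`setBernoulli_real_inter_disjoint_le`), `S` is independent with conditional probability at most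
`(1 - p) ^ M`. The expected gain `N * (1 - p) ^ M` is then bounded by a multiple of `|S| ^ α`
(`ncard_shadow_sdiff_mul_pow_le`), the worst case being `|S|` close to `p ^ (-1 / k)`. Summing along
the decision tree (`OracleAlgorithm.setIntegral_ncard_shadow_sub_le`) bounds the expected size of
the shadow by a multiple of the expected cost.
-/

/-! ### Random subsets of a finite set -/

section SetBernoulli

variable {ι : Type*} [Finite ι] (p : unitInterval)

/-- Adding the element `i` multiplies probabilities by `p / (1 - p)`. -/
theorem setBernoulli_real_image_insert {E : Set (Set ι)} {i : ι} (hE : ∀ s ∈ E, i ∉ s) :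
    (1 - p : ℝ) * (setBernoulli Set.univ p).real (insert i '' E) =
      p * (setBernoulli Set.univ p).real E := by
  classical
  have hfin (E : Set (Set ι)) : (setBernoulli Set.univ p).real E =
      ∑ s ∈ E.toFinite.toFinset, (setBernoulli Set.univ p).real {s} := by
    rw [sum_measureReal_singleton]
    simp
  have himg : (insert i '' E).toFinite.toFinset = E.toFinite.toFinset.image (insert i) := by
    ext; simp
  have hinj : Set.InjOn (insert i) (E.toFinite.toFinset : Set (Set ι)) := by
    intro s hs t ht hst
    have hs' := hE s (by simpa using hs)
    have ht' := hE t (by simpa using ht)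
    rw [← Set.insert_sdiff_self_of_notMem hs', hst, Set.insert_sdiff_self_of_notMem ht']
  rw [hfin, hfin, himg, Finset.sum_image hinj, Finset.mul_sum, Finset.mul_sum]
  refine Finset.sum_congr rfl fun s hs => ?_
  have hi : i ∉ s := hE s (by simpa using hs)
  have hc : (Set.univ \ s).ncard = (Set.univ \ insert i s).ncard + 1 := by
    rw [← Set.ncard_insert_of_notMem (a := i) (by simp) (Set.toFinite _)]
    congr 1
    ext j
    by_cases hj : j = i <;> simp_all
  rw [setBernoulli_real_singleton p (Set.subset_univ _) Set.finite_univ,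
    setBernoulli_real_singleton p (Set.subset_univ _) Set.finite_univ,
    Set.ncard_insert_of_notMem hi (Set.toFinite _), hc]
  ring

theorem setBernoulli_real_mem (i : ι) : (setBernoulli Set.univ p).real {s | i ∈ s} = p := by
  have h := setBernoulli_real_image_insert p (E := {s | i ∉ s}) (i := i) (by simp)
  have himg : insert i '' {s | i ∉ s} = {s : Set ι | i ∈ s} := by
    ext s
    constructor
    · rintro ⟨t, -, rfl⟩
      simp
    · intro hs
      exact ⟨s \ {i}, by simp, by simpa using Set.insert_eq_of_mem hs⟩
  have hcompl : (setBernoulli Set.univ p).real {s : Set ι | i ∉ s} =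
      1 - (setBernoulli Set.univ p).real {s : Set ι | i ∈ s} :=
    probReal_compl_eq_one_sub (.of_discrete)
  rw [himg, hcompl] at h
  linarith

/-- The expected number of elements of a fixed set that are selected. -/
theorem integral_ncard_inter_setBernoulli (T : Set ι) :
    ∫ s, ((s ∩ T).ncard : ℝ) ∂(setBernoulli Set.univ p) = p * T.ncard := by
  classical
  have hsum (s : Set ι) : ((s ∩ T).ncard : ℝ) =
      ∑ i ∈ T.toFinite.toFinset, {s : Set ι | i ∈ s}.indicator (fun _ => (1 : ℝ)) s := by
    rw [Set.ncard_eq_toFinset_card _ (Set.toFinite _)]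
    simp only [Set.indicator_apply, Set.mem_ofPred_eq, Finset.sum_boole]
    congr 2
    ext i
    simp [and_comm]
  simp_rw [hsum]
  rw [integral_finsetSum _ fun i _ => Integrable.of_finite]
  simp_rw [integral_indicator_const (1 : ℝ) (MeasurableSet.of_discrete), setBernoulli_real_mem]
  rw [Set.ncard_eq_toFinset_card _ (Set.toFinite _)]
  simp [mul_comm]

/-- A form of Harris' inequality: the event `W` being stable under adding elements of `D`, it is
negatively correlated with the event that no element of `D` is selected. -/
theorem setBernoulli_real_inter_disjoint_le (D : Set ι) (W : Set (Set ι))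
    (hW : ∀ i ∈ D, ∀ s ∈ W, insert i s ∈ W) :
    (setBernoulli Set.univ p).real (W ∩ {s | Disjoint s D}) ≤
      (1 - p : ℝ) ^ D.ncard * (setBernoulli Set.univ p).real W := by
  induction D, D.toFinite using Set.Finite.induction_on with
  | empty => simp
  | @insert i D hi hD ih =>
    have ih := ih fun j hj => hW j (Set.mem_insert_of_mem _ hj)
    set V := W ∩ {s | Disjoint s D}
    set E := V ∩ {s | i ∉ s}
    have hE : W ∩ {s | Disjoint s (insert i D)} = E := by
      ext s
      simp [E, V, Set.disjoint_insert_right, and_assoc, and_comm, and_left_comm]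
    have h := setBernoulli_real_image_insert p (E := E) (i := i) (by simp [E])
    -- `E` and its image under adding `i` are disjoint parts of `V`
    have hle : (setBernoulli Set.univ p).real E +
        (setBernoulli Set.univ p).real (insert i '' E) ≤ (setBernoulli Set.univ p).real V := by
      rw [← measureReal_union _ .of_discrete]
      · refine measureReal_mono (Set.union_subset Set.inter_subset_left ?_)
        rintro _ ⟨s, ⟨⟨hsW, hsD⟩, hs⟩, rfl⟩
        refine ⟨hW i (Set.mem_insert _ _) s hsW, ?_⟩
        simpa [Set.disjoint_insert_left, hi] using hsD
      · rw [Set.disjoint_left]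
        rintro _ ⟨-, hs⟩ ⟨t, -, rfl⟩
        simp at hs
    rw [hE, Set.ncard_insert_of_notMem hi hD, pow_succ]
    have hp : 0 ≤ (1 - p : ℝ) := sub_nonneg.2 p.2.2
    nlinarith [mul_le_mul_of_nonneg_left hle hp, mul_le_mul_of_nonneg_left ih hp]

end SetBernoulli

/-! ### Shadows of uniform hypergraphs -/

namespace UniformHypergraph

variable {n k r : ℕ}

/-- The complete hypergraph on the vertex set `S`: all size-`k` subsets of `S`. -/
def completeOn (k : ℕ) (S : Finset (Fin n)) : UniformHypergraph n k :=
  {e | (e : Finset (Fin n)) ⊆ S}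

/-- The `r`-shadow: all size-`r` sets that are contained in an edge. -/
def shadow (r : ℕ) (F : UniformHypergraph n k) : Set (Set.powersetCard (Fin n) r) :=
  {X | ∃ e ∈ F, (X : Finset (Fin n)) ⊆ (e : Finset (Fin n))}

theorem shadow_union (F F' : UniformHypergraph n k) :
    shadow r (F ∪ F') = shadow r F ∪ shadow r F' := by
  ext X
  simp only [shadow, Set.mem_ofPred_eq, Set.mem_union, or_and_right, exists_or]

theorem indOracle_eq_true_iff {G : UniformHypergraph n k} {S : Finset (Fin n)} :
    G.indOracle S = true ↔ Disjoint G (completeOn k S) := by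
  simp [indOracle, completeOn, Set.disjoint_left]

theorem ncard_between {X S : Finset (Fin n)} (hXS : X ⊆ S) :
    {e : Set.powersetCard (Fin n) k | X ⊆ (e : Finset (Fin n)) ∧ (e : Finset (Fin n)) ⊆ S}.ncard =
      if X.card ≤ k then (S.card - X.card).choose (k - X.card) else 0 := by
  classical
  split_ifs with hk
  · rw [← Finset.card_sdiff_of_subset hXS, ← Finset.card_powersetCard, ← Set.ncard_coe_finset]
    refine Set.ncard_congr (fun e _ => (e : Finset (Fin n)) \ X) ?_ ?_ ?_
    · rintro e ⟨hXe, heS⟩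
      rw [Finset.mem_coe, Finset.mem_powersetCard, Finset.card_sdiff_of_subset hXe, e.2]
      exact ⟨Finset.sdiff_subset_sdiff heS subset_rfl, rfl⟩
    · rintro e f ⟨hXe, -⟩ ⟨hXf, -⟩ h
      apply Subtype.ext
      rw [← Finset.sdiff_union_of_subset hXe, h, Finset.sdiff_union_of_subset hXf]
    · intro Y hY
      rw [Finset.mem_coe, Finset.mem_powersetCard] at hY
      have hdisj : Disjoint Y X := (Finset.subset_sdiff.1 hY.1).2
      refine ⟨⟨Y ∪ X, ?_⟩, ⟨?_, ?_⟩, ?_⟩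
      · rw [Set.powersetCard.mem_iff, Finset.card_union_of_disjoint hdisj, hY.2]
        omega
      · exact Finset.subset_union_right
      · exact Finset.union_subset (hY.1.trans Finset.sdiff_subset) hXS
      · exact Finset.union_sdiff_cancel_right hdisj
  · rw [Set.ncard_eq_zero (Set.toFinite _), Set.eq_empty_iff_forall_notMem]
    rintro e ⟨hXe, -⟩
    exact hk ((Finset.card_le_card hXe).trans_eq e.2)

theorem ncard_completeOn (S : Finset (Fin n)) : (completeOn k S).ncard = S.card.choose k := by
  simpa [completeOn] using ncard_between (k := k) (Finset.empty_subset S)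

theorem ncard_univ_powersetCard :
    (Set.univ : Set (Set.powersetCard (Fin n) k)).ncard = n.choose k := by
  simpa [completeOn] using ncard_completeOn (k := k) (Finset.univ : Finset (Fin n))

theorem ncard_star (hrk : r ≤ k) (X : Set.powersetCard (Fin n) r) :
    {e : Set.powersetCard (Fin n) k | (X : Finset (Fin n)) ⊆ (e : Finset (Fin n))}.ncard =
      (n - r).choose (k - r) := by
  simpa [hrk] using ncard_between (k := k) (Finset.subset_univ (X : Finset (Fin n)))

/-- Double counting of the pairs `X ⊆ e` where `X` is a size-`r` set that enters the shadow when
`completeOn k S` is added to `F`, and `e` is a size-`k` subset of `S` outside `F`: as `X` is not in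
the shadow of `F`, no size-`k` set between `X` and `S` is in `F`. -/
theorem ncard_shadow_sdiff_mul_le (hrk : r ≤ k) (F : UniformHypergraph n k) (S : Finset (Fin n)) :
    (shadow r (completeOn k S) \ shadow r F).ncard * (S.card - r).choose (k - r) ≤
      (completeOn k S \ F).ncard * k.choose r := by
  classical
  rw [Set.ncard_eq_toFinset_card' (shadow r (completeOn k S) \ shadow r F),
    Set.ncard_eq_toFinset_card' (completeOn k S \ F)]
  refine Finset.card_mul_le_card_mul (fun (X : Set.powersetCard (Fin n) r)
    (e : Set.powersetCard (Fin n) k) => (X : Finset (Fin n)) ⊆ (e : Finset (Fin n))) ?_ ?_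
  · intro X hX
    rw [Set.mem_toFinset] at hX
    obtain ⟨⟨e₀, he₀S, hXe₀⟩, hXF⟩ := hX
    have hXS : (X : Finset (Fin n)) ⊆ S := hXe₀.trans he₀S
    have h := ncard_between (k := k) hXS
    rw [Set.powersetCard.card_eq, if_pos hrk] at h
    rw [← h, ← Set.ncard_coe_finset]
    refine Set.ncard_le_ncard ?_ (Set.toFinite _)
    rintro e ⟨hXe, heS⟩
    simp only [Finset.mem_coe, Finset.mem_bipartiteAbove, Set.mem_toFinset]
    exact ⟨⟨heS, fun heF => hXF ⟨e, heF, hXe⟩⟩, hXe⟩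
  · intro e _
    have h := ncard_completeOn (k := r) (e : Finset (Fin n))
    rw [Set.powersetCard.card_eq] at h
    rw [← h, ← Set.ncard_coe_finset]
    refine Set.ncard_le_ncard ?_ (Set.toFinite _)
    intro X hX
    simp only [Finset.mem_coe, Finset.mem_bipartiteBelow] at hX
    exact hX.2

theorem ncard_shadow_sdiff_le (F : UniformHypergraph n k) (S : Finset (Fin n)) :
    (shadow r (completeOn k S) \ shadow r F).ncard ≤ S.card.choose r := by
  rw [← ncard_completeOn]
  refine Set.ncard_le_ncard ?_ (Set.toFinite _)
  rintro X ⟨⟨e, heS, hXe⟩, -⟩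
  exact hXe.trans heS

theorem shadow_completeOn_eq_empty {S : Finset (Fin n)} (hS : S.card < k) :
    shadow r (completeOn k S) = ∅ := by
  rw [Set.eq_empty_iff_forall_notMem]
  rintro X ⟨e, heS, -⟩
  exact hS.not_ge (e.2.symm.trans_le (Finset.card_le_card heS))

end UniformHypergraph

/-! ### Non-edges found by an oracle algorithm -/

namespace OracleAlgorithm

open UniformHypergraph

variable {n k r : ℕ} {β : Type*}

/-- The non-edges that are known once the algorithm halts, when those in `F` were known at the
start: `F` and all size-`k` subsets of the queried sets that turned out to be independent. -/
noncomputable def knownNonedges (G : UniformHypergraph n k) :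
    UniformHypergraph n k → OracleAlgorithm (Fin n) β → UniformHypergraph n k
  | F, output _ => F
  | F, query S next =>
    if G.indOracle S then knownNonedges G (F ∪ completeOn k S) (next true)
    else knownNonedges G F (next false)

theorem subset_knownNonedges (G F : UniformHypergraph n k) (A : OracleAlgorithm (Fin n) β) :
    F ⊆ knownNonedges G F A := by
  induction A generalizing F with
  | output b => exact subset_rfl
  | query S next ih =>
    rw [knownNonedges]
    split_ifs
    · exact Set.subset_union_left.trans (ih true _)
    · exact ih false F

/-- The algorithm distinguishes `G` from `G ∪ ofRoots k R` only through an independent query of `G`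
that contains a size-`k` set with a root. -/
theorem exists_root_of_run_ne (G F : UniformHypergraph n k)
    (R : Set (Set.powersetCard (Fin n) r)) (A : OracleAlgorithm (Fin n) β)
    (h : A.run G.indOracle ≠ A.run (G ∪ ofRoots k R).indOracle) :
    (R ∩ shadow r (knownNonedges G F A)).Nonempty := by
  induction A generalizing F with
  | output b => exact absurd rfl h
  | query S next ih =>
    rw [run, run] at h
    rw [knownNonedges]
    by_cases hS : Disjoint G (completeOn k S)
    · rw [indOracle_eq_true_iff.2 hS] at h ⊢
      rw [if_pos rfl]
      by_cases hR : Disjoint (ofRoots k R) (completeOn k S)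
      · rw [indOracle_eq_true_iff.2 (Set.disjoint_union_left.2 ⟨hS, hR⟩)] at h
        exact ih true _ h
      · obtain ⟨e, ⟨X, hXR, hXe⟩, heS⟩ := Set.not_disjoint_iff.1 hR
        exact ⟨X, hXR, e, subset_knownNonedges _ _ _ (Or.inr heS), hXe⟩
    · have h1 : G.indOracle S = false := by
        rw [← Bool.not_eq_true, indOracle_eq_true_iff]
        exact hS
      have h2 : (G ∪ ofRoots k R).indOracle S = false := by
        rw [← Bool.not_eq_true, indOracle_eq_true_iff]
        exact fun hd => hS (Set.disjoint_union_left.1 hd).1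
      rw [h1, h2] at h
      rw [h1, if_neg Bool.false_ne_true]
      exact ih false F h

theorem oracleCost_query (c : ℕ → ℝ) (S : Finset (Fin n))
    (next : Bool → OracleAlgorithm (Fin n) β) (O : Finset (Fin n) → Bool) :
    (query S next).oracleCost c O = c S.card + (next (O S)).oracleCost c O := by
  simp [oracleCost, queries]

/-- The shadow of the known non-edges grows, on average, by at most `l` times the cost, if each
single query `S` satisfies such a bound: with `M` the number of size-`k` subsets of `S` that are not
yet known to be non-edges, `S` is independent with probability at most `(1 - p) ^ M`. The event
that the algorithm is in a given state is that no edge is in `F`, and that an upward closed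
condition `U` (each of the other queried sets contains an edge) holds. -/
theorem setIntegral_ncard_shadow_sub_le (p : unitInterval) (c : ℕ → ℝ) (l : ℝ)
    (hc : ∀ (F : UniformHypergraph n k) (S : Finset (Fin n)),
      ((shadow r (completeOn k S) \ shadow r F).ncard : ℝ) *
        (1 - p : ℝ) ^ (completeOn k S \ F).ncard ≤ l * c S.card)
    (A : OracleAlgorithm (Fin n) β) (F : UniformHypergraph n k)
    (U : Set (UniformHypergraph n k)) (hU : IsUpperSet U) :
    ∫ G in {G | Disjoint G F} ∩ U,
        (((shadow r (knownNonedges G F A)).ncard : ℝ) - (shadow r F).ncard) ∂(erdosRenyi n k p) ≤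
      l * ∫ G in {G | Disjoint G F} ∩ U, A.oracleCost c G.indOracle ∂(erdosRenyi n k p) := by
  induction A generalizing F U with
  | output b => simp [knownNonedges, oracleCost, queries]
  | query S next ih =>
    set μ := erdosRenyi n k p with hμ
    have : IsProbabilityMeasure μ := by rw [hμ, erdosRenyi]; infer_instance
    set W : Set (UniformHypergraph n k) := {G | Disjoint G F} ∩ U with hW
    set I : Set (UniformHypergraph n k) := {G | Disjoint G (completeOn k S)} with hI
    have hWI : W ∩ I = {G | Disjoint G (F ∪ completeOn k S)} ∩ U := by
      ext G
      simp only [hW, hI, Set.mem_inter_iff, Set.mem_ofPred_eq, Set.disjoint_union_right]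
      tauto
    have hWI' : W ∩ Iᶜ = {G | Disjoint G F} ∩ (U ∩ Iᶜ) := Set.inter_assoc _ _ _
    have hUI : IsUpperSet (U ∩ Iᶜ) :=
      hU.inter fun G G' hGG' hG hG' => hG (Set.disjoint_of_subset_left hGG' hG')
    have h1 := ih true (F ∪ completeOn k S) U hU
    have h2 := ih false F (U ∩ Iᶜ) hUI
    rw [← hWI] at h1
    rw [← hWI'] at h2
    have split (f : UniformHypergraph n k → ℝ) :
        ∫ G in W, f G ∂μ = ∫ G in W ∩ I, f G ∂μ + ∫ G in W ∩ Iᶜ, f G ∂μ :=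
      (integral_inter_add_sdiff .of_discrete Integrable.of_finite.integrableOn).symm
    have hprob : μ.real (W ∩ I) ≤ (1 - p : ℝ) ^ (completeOn k S \ F).ncard * μ.real W := by
      have h := setBernoulli_real_inter_disjoint_le p (completeOn k S \ F) W ?_
      · refine le_trans (measureReal_mono ?_) h
        exact Set.inter_subset_inter_right _ fun G hG =>
          Set.disjoint_of_subset_right Set.sdiff_subset hG
      · rintro e ⟨-, heF⟩ G ⟨hGF, hGU⟩
        exact ⟨Set.disjoint_insert_left.2 ⟨heF, hGF⟩, hU (Set.subset_insert _ _) hGU⟩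
    have hcard : ((shadow r (F ∪ completeOn k S)).ncard : ℝ) =
        (shadow r F).ncard + (shadow r (completeOn k S) \ shadow r F).ncard := by
      rw [shadow_union, ← Set.union_sdiff_self,
        Set.ncard_union_eq Set.disjoint_sdiff_right (Set.toFinite _) (Set.toFinite _)]
      push_cast
      rfl
    set N : ℝ := ((shadow r (completeOn k S) \ shadow r F).ncard : ℝ) with hN
    have hNc : N * μ.real (W ∩ I) ≤ l * c S.card * μ.real W := by
      calc N * μ.real (W ∩ I)
          ≤ N * ((1 - p : ℝ) ^ (completeOn k S \ F).ncard * μ.real W) := by gcongr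
        _ = N * (1 - p : ℝ) ^ (completeOn k S \ F).ncard * μ.real W := by ring
        _ ≤ l * c S.card * μ.real W :=
          mul_le_mul_of_nonneg_right (hc F S) measureReal_nonneg
    have hL1 : ∫ G in W ∩ I, (((shadow r (knownNonedges G F (query S next))).ncard : ℝ) -
          (shadow r F).ncard) ∂μ =
        ∫ G in W ∩ I, (((shadow r (knownNonedges G (F ∪ completeOn k S) (next true))).ncard : ℝ) -
          (shadow r (F ∪ completeOn k S)).ncard) ∂μ + N * μ.real (W ∩ I) := by
      rw [mul_comm, ← smul_eq_mul, ← setIntegral_const,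
        ← integral_add Integrable.of_finite Integrable.of_finite]
      refine setIntegral_congr_fun .of_discrete fun G hG => ?_
      have hGI : G.indOracle S = true := indOracle_eq_true_iff.2 hG.2
      simp only [knownNonedges, hGI, if_true]
      rw [hcard]
      ring
    have hL2 : ∫ G in W ∩ Iᶜ, (((shadow r (knownNonedges G F (query S next))).ncard : ℝ) -
          (shadow r F).ncard) ∂μ =
        ∫ G in W ∩ Iᶜ, (((shadow r (knownNonedges G F (next false))).ncard : ℝ) -
          (shadow r F).ncard) ∂μ := by
      refine setIntegral_congr_fun .of_discrete fun G hG => ?_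
      have hGI : ¬ G.indOracle S = true := fun h => hG.2 (indOracle_eq_true_iff.1 h)
      simp only [knownNonedges, hGI, if_false, Bool.false_eq_true]
    have hR : ∫ G in W, (query S next).oracleCost c G.indOracle ∂μ = c S.card * μ.real W +
        (∫ G in W ∩ I, (next true).oracleCost c G.indOracle ∂μ +
          ∫ G in W ∩ Iᶜ, (next false).oracleCost c G.indOracle ∂μ) := by
      simp_rw [oracleCost_query]
      rw [integral_add Integrable.of_finite Integrable.of_finite, setIntegral_const, smul_eq_mul,
        mul_comm, split]
      congr 2
      · refine setIntegral_congr_fun .of_discrete fun G hG => ?_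
        have hGI : G.indOracle S = true := indOracle_eq_true_iff.2 hG.2
        simp only [hGI]
      · refine setIntegral_congr_fun .of_discrete fun G hG => ?_
        have hGI : G.indOracle S = false :=
          Bool.eq_false_iff.2 fun h => hG.2 (indOracle_eq_true_iff.1 h)
        simp only [hGI]
    rw [split, hL1, hL2, hR]
    linarith

end OracleAlgorithm

/-! ### The correlated pair of hypergraphs -/

namespace UniformHypergraph

variable {n k r : ℕ}

instance (p : unitInterval) : IsProbabilityMeasure (erdosRenyi n k p) := by
  rw [erdosRenyi]; infer_instance

theorem rootedPair_real (p q : unitInterval)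
    (E : Set (UniformHypergraph n k × UniformHypergraph n k)) :
    (rootedPair n k r p q).real E =
      ((erdosRenyi n k p).prod (setBernoulli Set.univ q)).real
        {x : UniformHypergraph n k × Set (Set.powersetCard (Fin n) r) |
          (x.1, x.1 ∪ ofRoots k x.2) ∈ E} := by
  rw [rootedPair, map_measureReal_apply .of_discrete .of_discrete]
  rfl

/-- An algorithm that distinguishes the two hypergraphs must have found a root in the shadow of the
non-edges it knows, and the number of such roots has expectation at most `q * l` times the cost. -/
theorem real_run_ne_le {β : Type*} (p q : unitInterval) (c : ℕ → ℝ) (l : ℝ)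
    (hc : ∀ (F : UniformHypergraph n k) (S : Finset (Fin n)),
      ((shadow r (completeOn k S) \ shadow r F).ncard : ℝ) *
        (1 - p : ℝ) ^ (completeOn k S \ F).ncard ≤ l * c S.card)
    (A : OracleAlgorithm (Fin n) β) :
    (rootedPair n k r p q).real {G | A.run G.1.indOracle ≠ A.run G.2.indOracle} ≤
      q * (l * ∫ G, A.oracleCost c G.1.indOracle ∂(rootedPair n k r p q)) := by
  classical
  have hcost : ∫ G, A.oracleCost c G.1.indOracle ∂(rootedPair n k r p q) =
      ∫ G, A.oracleCost c G.indOracle ∂(erdosRenyi n k p) := by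
    rw [rootedPair, integral_map Measurable.of_discrete.aemeasurable
      Measurable.of_discrete.aestronglyMeasurable, integral_prod _ Integrable.of_finite]
    simp
  have hmain := A.setIntegral_ncard_shadow_sub_le p c l hc ∅ Set.univ isUpperSet_univ
  have hshadow : shadow r (∅ : UniformHypergraph n k) = ∅ := by simp [shadow]
  simp only [hshadow, Set.disjoint_empty, Set.ofPred_true, Set.univ_inter, Set.ncard_empty,
    Nat.cast_zero, sub_zero, setIntegral_univ] at hmain
  rw [hcost, rootedPair_real, ← integral_indicator_one .of_discrete,
    integral_prod _ Integrable.of_finite]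
  refine le_trans ?_ (mul_le_mul_of_nonneg_left hmain q.2.1)
  rw [← integral_const_mul]
  refine integral_mono Integrable.of_finite Integrable.of_finite fun G => ?_
  simp only
  rw [← integral_ncard_inter_setBernoulli]
  refine integral_mono Integrable.of_finite Integrable.of_finite fun R => ?_
  simp only
  rw [Set.indicator_apply]
  split_ifs with hR
  swap
  · positivity
  have h := A.exists_root_of_run_ne G ∅ R hR
  simpa [Nat.one_le_cast, Nat.one_le_iff_ne_zero, Set.ncard_eq_zero (Set.toFinite _)] using
    h.ne_empty

/-- Given that there is a root, the expected value of the number of edges of `G₁` that contain a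
fixed root plus `ε * e(G₁)` is small compared to the number of size-`k` sets that contain it. -/
theorem rootedPair_real_edgeCount_le (hrk : r ≤ k) (hkn : k ≤ n) (p q : unitInterval) {ε : ℝ}
    (hε : 0 ≤ ε) :
    (rootedPair n k r p q).real
        {G | (1 + ε) * (G.1.edgeCount : ℝ) < (G.2.edgeCount : ℝ)}ᶜ ≤
      (1 - q : ℝ) ^ n.choose r + p + ε * p * n.choose k / (n - r).choose (k - r) := by
  classical
  have hm : (0 : ℝ) < (n - r).choose (k - r) := by
    exact_mod_cast Nat.choose_pos (by omega)
  set m : ℝ := ((n - r).choose (k - r) : ℝ) with hmdef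
  obtain ⟨X₀⟩ : Nonempty (Set.powersetCard (Fin n) r) := by
    obtain ⟨s, -, hs⟩ := Finset.exists_subset_card_eq
      (s := (Finset.univ : Finset (Fin n))) (n := r) (by simpa using hrk.trans hkn)
    exact ⟨⟨s, hs⟩⟩
  let x (R : Set (Set.powersetCard (Fin n) r)) : Set.powersetCard (Fin n) r :=
    if h : R.Nonempty then h.some else X₀
  let star (X : Set.powersetCard (Fin n) r) : UniformHypergraph n k :=
    {e | (X : Finset (Fin n)) ⊆ (e : Finset (Fin n))}
  have hstar (X : Set.powersetCard (Fin n) r) : ((star X).ncard : ℝ) = m := by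
    rw [hmdef, ncard_star hrk X]
  rw [rootedPair_real, ← integral_indicator_one .of_discrete,
    integral_prod_symm _ Integrable.of_finite]
  calc _ ≤ ∫ R, (({∅} : Set (Set (Set.powersetCard (Fin n) r))).indicator (fun _ => (1 : ℝ)) R +
          (p + ε * p * n.choose k / m)) ∂(setBernoulli Set.univ q) := by
        refine integral_mono Integrable.of_finite Integrable.of_finite fun R => ?_
        simp only
        calc _ ≤ ∫ G, (({∅} : Set (Set (Set.powersetCard (Fin n) r))).indicator
                  (fun _ => (1 : ℝ)) R +
                ((G ∩ star (x R)).ncard + ε * (G ∩ Set.univ).ncard) / m)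
                  ∂(erdosRenyi n k p) := by
              refine integral_mono Integrable.of_finite Integrable.of_finite fun G => ?_
              simp only
              rw [Set.indicator_apply]
              split_ifs with hG
              · by_cases hR : R.Nonempty
                · have hxR : x R ∈ R := by
                    simp only [x, dif_pos hR]
                    exact hR.some_mem
                  rw [Set.indicator_of_notMem (by simpa using hR.ne_empty), zero_add, Pi.one_apply,
                    le_div_iff₀ hm, one_mul, Set.inter_univ]
                  have hG' : ((G ∪ ofRoots k R).ncard : ℝ) ≤ (1 + ε) * (G.ncard : ℝ) :=
                    not_lt.1 hG
                  have hsub : G ∪ star (x R) ⊆ G ∪ ofRoots k R :=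
                    Set.union_subset_union_right _ fun e he => ⟨x R, hxR, he⟩
                  have hle : ((G ∪ star (x R)).ncard : ℝ) ≤ (G ∪ ofRoots k R).ncard := by
                    exact_mod_cast Set.ncard_le_ncard hsub (Set.toFinite _)
                  have hadd : ((G ∪ star (x R)).ncard : ℝ) + (G ∩ star (x R)).ncard =
                      G.ncard + (star (x R)).ncard := by
                    exact_mod_cast Set.ncard_union_add_ncard_inter _ _ (Set.toFinite _)
                      (Set.toFinite _)
                  rw [hstar] at hadd
                  linarith
                · rw [Set.not_nonempty_iff_eq_empty] at hR
                  rw [Set.indicator_of_mem (by simpa using hR), Pi.one_apply]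
                  have : 0 ≤ ((G ∩ star (x R)).ncard + ε * (G ∩ Set.univ).ncard) / m := by
                    positivity
                  linarith
              · exact add_nonneg (Set.indicator_nonneg (fun _ _ => zero_le_one) _)
                  (by positivity)
          _ = _ := by
              rw [integral_add Integrable.of_finite Integrable.of_finite, integral_const,
                integral_div, integral_add Integrable.of_finite Integrable.of_finite,
                integral_const_mul, erdosRenyi, integral_ncard_inter_setBernoulli,
                integral_ncard_inter_setBernoulli, hstar, ncard_univ_powersetCard]
              simp only [probReal_univ, one_smul]
              field_simp
    _ = _ := by
        rw [integral_add Integrable.of_finite Integrable.of_finite, integral_const,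
          integral_indicator_const _ .of_discrete,
          setBernoulli_real_singleton q (Set.empty_subset _) Set.finite_univ, Set.sdiff_empty,
          ncard_univ_powersetCard]
        simp [add_assoc]

end UniformHypergraph

/-! ### Estimates for a single query -/

section Estimates

/-- A lower bound for binomial coefficients, which follows factor by factor from
`x / k ≤ (x - i) / (k - i)`. -/
theorem pow_le_pow_mul_choose {r k x : ℕ} (hrk : r ≤ k) (hkx : k ≤ x) :
    x ^ (k - r) ≤ k ^ (k - r) * (x - r).choose (k - r) := by
  obtain ⟨j, rfl⟩ := Nat.exists_eq_add_of_le hrk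
  obtain ⟨y, rfl⟩ := Nat.exists_eq_add_of_le hkx
  rw [show r + j - r = j by omega, show r + j + y - r = j + y by omega]
  induction j generalizing r with
  | zero => simp
  | succ j ih =>
    have ih := ih (r := r + 1) (by omega) (by omega)
    rw [show r + 1 + j = r + (j + 1) by ring] at ih
    have hch := Nat.add_one_mul_choose_eq (j + y) j
    have hstep : (r + (j + 1) + y) * (j + 1) ≤ (r + (j + 1)) * (j + y + 1) := by nlinarith
    refine Nat.le_of_mul_le_mul_right ?_ (Nat.add_one_pos j)
    calc (r + (j + 1) + y) ^ (j + 1) * (j + 1)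
        = (r + (j + 1) + y) ^ j * ((r + (j + 1) + y) * (j + 1)) := by ring
      _ ≤ ((r + (j + 1)) ^ j * (j + y).choose j) * ((r + (j + 1)) * (j + y + 1)) :=
          Nat.mul_le_mul ih hstep
      _ = (r + (j + 1)) ^ (j + 1) * ((j + y + 1) * (j + y).choose j) := by ring
      _ = (r + (j + 1)) ^ (j + 1) * ((j + 1 + y).choose (j + 1) * (j + 1)) := by
          rw [hch, show j + 1 + y = j + y + 1 by ring]
      _ = _ := by ring

/-- `M * (1 - p) ^ M` is at most `1 / p`. -/
theorem mul_one_sub_pow_mul_le_one {p : ℝ} (hp0 : 0 ≤ p) (hp1 : p ≤ 1) (M : ℕ) :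
    p * (M * (1 - p) ^ M) ≤ 1 := by
  have h1 : (1 - p) ^ M * (1 + p) ^ M ≤ 1 := by
    rw [← mul_pow]
    exact pow_le_one₀ (by nlinarith) (by nlinarith)
  have h2 : 1 + M * p ≤ (1 + p) ^ M := one_add_mul_le_pow (by linarith) M
  have h3 : 0 ≤ (1 - p) ^ M := pow_nonneg (by linarith) M
  nlinarith [mul_le_mul_of_nonneg_left h2 h3]

open UniformHypergraph in
/-- The gain of a single query of size `x`: for `p * x ^ k ≤ 1` the number of all size-`r` subsets
is a sufficient bound, and otherwise it is unlikely that the query is independent. -/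
theorem ncard_shadow_sdiff_mul_pow_le {n k r : ℕ} {α : ℝ} (hk : 1 ≤ k) (hrk : r ≤ k)
    (hα0 : 0 ≤ α) (hαr : α ≤ r) (p : unitInterval) (hp : 0 < (p : ℝ))
    (F : UniformHypergraph n k) (S : Finset (Fin n)) :
    ((shadow r (completeOn k S) \ shadow r F).ncard : ℝ) *
        (1 - p : ℝ) ^ (completeOn k S \ F).ncard ≤
      ((k : ℝ) ^ k * (p : ℝ)⁻¹ ^ ((r - α) / k)) * powerCost α S.card := by
  have hp1 : (p : ℝ) ≤ 1 := p.2.2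
  have hk0 : (0 : ℝ) < k := by exact_mod_cast hk
  have hk1 : (1 : ℝ) ≤ k := by exact_mod_cast hk
  have hrk' : (r : ℝ) ≤ k := by exact_mod_cast hrk
  rcases lt_or_ge S.card k with hS | hS
  · rw [shadow_completeOn_eq_empty hS]
    simp only [Set.empty_sdiff, Set.ncard_empty, Nat.cast_zero, zero_mul]
    unfold powerCost
    split_ifs <;> positivity
  set x := S.card with hx
  have hN1 := ncard_shadow_sdiff_le (r := r) F S
  have hN2 := ncard_shadow_sdiff_mul_le hrk F S
  rw [← hx] at hN1 hN2
  set N := (shadow r (completeOn k S) \ shadow r F).ncard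
  set M := (completeOn k S \ F).ncard
  have hx0 : (0 : ℝ) < x := by exact_mod_cast (by omega : 0 < x)
  rw [powerCost, if_neg (by omega : x ≠ 0)]
  have hq0 : 0 ≤ (1 - p : ℝ) := by linarith
  have hθ : 0 ≤ ((r : ℝ) - α) / k := div_nonneg (by linarith) hk0.le
  rcases le_total ((p : ℝ) * (x : ℝ) ^ k) 1 with h | h
  · have hNx : (N : ℝ) ≤ (x : ℝ) ^ r := by
      exact_mod_cast hN1.trans (Nat.choose_le_pow x r)
    have hle : (x : ℝ) ^ ((r : ℝ) - α) ≤ (p : ℝ)⁻¹ ^ (((r : ℝ) - α) / k) := by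
      have h1 : (x : ℝ) ^ k ≤ (p : ℝ)⁻¹ := by
        rw [← one_div, le_div_iff₀ hp]
        linarith
      have h2 := Real.rpow_le_rpow (by positivity) h1 hθ
      rwa [← Real.rpow_natCast, ← Real.rpow_mul hx0.le, mul_div_cancel₀ _ hk0.ne'] at h2
    calc (N : ℝ) * (1 - p : ℝ) ^ M ≤ N * 1 := by
          gcongr
          exact pow_le_one₀ hq0 (by linarith)
      _ ≤ (x : ℝ) ^ r := by linarith
      _ = 1 * (x : ℝ) ^ ((r : ℝ) - α) * (x : ℝ) ^ α := by
          rw [one_mul, ← Real.rpow_add hx0, sub_add_cancel, Real.rpow_natCast]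
      _ ≤ _ := by
          gcongr
          exact one_le_pow₀ hk1
  · have hC := pow_le_pow_mul_choose hrk hS
    have hC' : (x : ℝ) ^ (k - r) ≤ (k : ℝ) ^ (k - r) * (x - r).choose (k - r) := by
      exact_mod_cast hC
    have hkr : ((k.choose r : ℕ) : ℝ) ≤ (k : ℝ) ^ r := by exact_mod_cast Nat.choose_le_pow k r
    have hM := mul_one_sub_pow_mul_le_one hp.le hp1 M
    have hN2' : (N : ℝ) * (x - r).choose (k - r) ≤ M * k.choose r := by exact_mod_cast hN2
    have hQ : 0 ≤ (1 - p : ℝ) ^ M := pow_nonneg hq0 M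
    -- the bound `x ^ (k - r) * N * (1 - p) ^ M ≤ k ^ k / p`
    have hmain : (x : ℝ) ^ (k - r) * ((N : ℝ) * (1 - p : ℝ) ^ M) * p ≤ (k : ℝ) ^ k := by
      calc (x : ℝ) ^ (k - r) * ((N : ℝ) * (1 - p : ℝ) ^ M) * p
          ≤ ((k : ℝ) ^ (k - r) * (x - r).choose (k - r)) * (N * (1 - p : ℝ) ^ M) * p := by
            gcongr
        _ = (k : ℝ) ^ (k - r) * (N * (x - r).choose (k - r)) * ((1 - p : ℝ) ^ M * p) := by ring
        _ ≤ (k : ℝ) ^ (k - r) * (M * k.choose r) * ((1 - p : ℝ) ^ M * p) := by gcongr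
        _ = (k : ℝ) ^ (k - r) * k.choose r * (p * (M * (1 - p : ℝ) ^ M)) := by ring
        _ ≤ (k : ℝ) ^ (k - r) * (k : ℝ) ^ r * 1 := by gcongr
        _ = (k : ℝ) ^ k := by rw [mul_one, ← pow_add, Nat.sub_add_cancel hrk]
    have hpow : 1 ≤ (p : ℝ) ^ (1 - ((r : ℝ) - α) / k) * (x : ℝ) ^ ((k : ℝ) - r + α) := by
      have h2 := Real.one_le_rpow h (z := 1 - ((r : ℝ) - α) / k) ?_
      · rw [Real.mul_rpow hp.le (by positivity), ← Real.rpow_natCast (x : ℝ),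
          ← Real.rpow_mul hx0.le] at h2
        rwa [show (k : ℝ) * (1 - ((r : ℝ) - α) / k) = (k : ℝ) - r + α by field_simp; ring] at h2
      · rw [sub_nonneg, div_le_one hk0]
        linarith
    have hX : (x : ℝ) ^ ((k : ℝ) - r + α) = (x : ℝ) ^ (k - r) * (x : ℝ) ^ α := by
      rw [Real.rpow_add hx0, ← Nat.cast_sub hrk, Real.rpow_natCast]
    have hP : (p : ℝ) ^ (1 - ((r : ℝ) - α) / k) = p * (p : ℝ)⁻¹ ^ (((r : ℝ) - α) / k) := by
      rw [Real.rpow_sub hp, Real.rpow_one, Real.inv_rpow hp.le, div_eq_mul_inv]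
    rw [hX, hP] at hpow
    have hpos : 0 < (x : ℝ) ^ (k - r) * p := by positivity
    refine le_of_mul_le_mul_left ?_ hpos
    calc (x : ℝ) ^ (k - r) * p * ((N : ℝ) * (1 - p : ℝ) ^ M)
        = (x : ℝ) ^ (k - r) * ((N : ℝ) * (1 - p : ℝ) ^ M) * p := by ring
      _ ≤ (k : ℝ) ^ k * 1 := by rwa [mul_one]
      _ ≤ (k : ℝ) ^ k * (p * (p : ℝ)⁻¹ ^ (((r : ℝ) - α) / k) *
            ((x : ℝ) ^ (k - r) * (x : ℝ) ^ α)) := by gcongr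
      _ = _ := by ring

/-- For `r` small compared to `√n`, the falling factorial of `n` is close to `n ^ r`. -/
theorem pow_le_two_mul_factorial_mul_choose {n r : ℕ} (hr : 2 * r ^ 2 ≤ n) (hn : 0 < n) :
    (n : ℝ) ^ r ≤ 2 * (r ! * n.choose r) := by
  have hrn : r ≤ n := by nlinarith
  have hn0 : (0 : ℝ) < n := by exact_mod_cast hn
  have hr' : 2 * (r : ℝ) ^ 2 ≤ n := by exact_mod_cast hr
  have hrn' : (r : ℝ) ≤ n := by exact_mod_cast hrn
  have h1 : ((n + 1 - r : ℕ) : ℝ) ^ r ≤ r ! * n.choose r := by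
    exact_mod_cast (Nat.pow_sub_le_descFactorial n r).trans_eq
      (Nat.descFactorial_eq_factorial_mul_choose n r)
  have h2 : (n : ℝ) - r ≤ ((n + 1 - r : ℕ) : ℝ) := by
    rw [Nat.cast_sub (by omega)]
    push_cast
    linarith
  have h3 : 1 + (r : ℝ) * (-(r / n)) ≤ (1 + -(r / n : ℝ)) ^ r :=
    one_add_mul_le_pow (by have := (div_le_one hn0).2 hrn'; linarith) r
  have h4 : (r : ℝ) * (r / n) ≤ 1 / 2 := by
    rw [← mul_div_assoc, div_le_div_iff₀ hn0 two_pos]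
    nlinarith
  have h5 : ((n : ℝ) - r) ^ r = (n : ℝ) ^ r * (1 + -(r / n : ℝ)) ^ r := by
    rw [← mul_pow]
    congr 1
    field_simp
    ring
  have h6 : ((n : ℝ) - r) ^ r ≤ r ! * n.choose r :=
    (pow_le_pow_left₀ (by linarith) h2 r).trans h1
  have h7 : (n : ℝ) ^ r * (1 / 2) ≤ ((n : ℝ) - r) ^ r := by
    rw [h5]
    gcongr
    linarith
  linarith

end Estimates

/-! ### The lower bound -/

theorem theorem3p15 (n k r : ℕ) (α ε : ℝ)
    (hkn : (k : ℝ) ≤ √(n : ℝ) / 10 ^ 4) (hrk : r ≤ k) (hαr : α ≤ (r : ℝ)) (hα : 1 ≤ α)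
    (hε0 : 0 < ε) (hε1 : ε < 1) (hε : 240 * (k ! : ℝ) / (n : ℝ) ^ r ≤ ε) :
    ∃ p q : unitInterval,
      0.95 ≤ (UniformHypergraph.rootedPair n k r p q).real
          {G | (1 + ε) * (G.1.edgeCount : ℝ) < (G.2.edgeCount : ℝ)} ∧
      ∀ (β : Type*) (A : OracleAlgorithm (Fin n) β),
        2 / 3 ≤ (UniformHypergraph.rootedPair n k r p q).real
            {G | A.run G.1.indOracle ≠ A.run G.2.indOracle} →
        (n : ℝ) ^ ((r : ℝ) * ((k : ℝ) - r + α) / k) /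
            (1080 * (k : ℝ) ^ (3 * k) * ε ^ (((r : ℝ) - α) / k)) ≤
          ∫ G, A.oracleCost (powerCost α) G.1.indOracle
            ∂(UniformHypergraph.rootedPair n k r p q) := by
  have hr1 : 1 ≤ r := by exact_mod_cast hα.trans hαr
  have hk1 : 1 ≤ k := hr1.trans hrk
  have hk1' : (1 : ℝ) ≤ k := by exact_mod_cast hk1
  have hrk' : (r : ℝ) ≤ k := by exact_mod_cast hrk
  have hk0 : (0 : ℝ) < k := by linarith
  have hk2n : (10 : ℝ) ^ 8 * (k : ℝ) ^ 2 ≤ n := by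
    have h : (10 ^ 4 * (k : ℝ)) ^ 2 ≤ √(n : ℝ) ^ 2 := by
      gcongr
      linarith
    rw [Real.sq_sqrt (Nat.cast_nonneg n)] at h
    nlinarith
  have hk2n' : 10 ^ 8 * k ^ 2 ≤ n := by exact_mod_cast hk2n
  have hn0 : 0 < n := by nlinarith
  have hkn' : 4 * k ≤ n := by nlinarith
  have hr2 : 2 * r ^ 2 ≤ n := by nlinarith
  have hn0' : (0 : ℝ) < n := by exact_mod_cast hn0
  set C : ℝ := (n.choose r : ℝ) with hCdef
  have hC0 : 0 < C := by
    rw [hCdef]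
    exact_mod_cast Nat.choose_pos (by omega)
  have hnC : (n : ℝ) ^ r ≤ (k : ℝ) ^ k * C := by
    have h := pow_le_pow_mul_choose (Nat.zero_le r) (by omega : r ≤ n)
    simp only [Nat.sub_zero] at h
    have h' : (n : ℝ) ^ r ≤ (r : ℝ) ^ r * C := by
      rw [hCdef]
      exact_mod_cast h
    refine h'.trans ?_
    gcongr
    exact (pow_le_pow_left₀ (Nat.cast_nonneg r) hrk' r).trans (pow_le_pow_right₀ hk1' hrk)
  have hCn : C ≤ (n : ℝ) ^ r := by
    rw [hCdef]
    exact_mod_cast Nat.choose_le_pow n r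
  have h4C : 4 ≤ C := by
    have h := pow_le_pow_mul_choose (Nat.zero_le r) (by omega : r ≤ n)
    simp only [Nat.sub_zero] at h
    have h2 : (4 * r) ^ r ≤ n ^ r := Nat.pow_le_pow_left (by omega) r
    rw [mul_pow] at h2
    have h3 : 4 ^ r * r ^ r ≤ n.choose r * r ^ r := by linarith
    have h4 : 4 ^ r ≤ n.choose r := Nat.le_of_mul_le_mul_right h3 (by positivity)
    have h5 : 4 ≤ n.choose r := (Nat.le_self_pow (by omega) 4).trans h4
    rw [hCdef]
    exact_mod_cast h5
  set B : ℝ := (k.choose r : ℝ) with hBdef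
  have hB1 : 1 ≤ B := by
    rw [hBdef]
    exact_mod_cast Nat.choose_pos hrk
  -- with this choice `ε * p * n.choose k` is `1 / 100` of `(n - r).choose (k - r)`
  set p₀ : ℝ := B / (100 * ε * C) with hp₀
  have hp₀pos : 0 < p₀ := by positivity
  -- the lower bound on `ε` bounds the edge probability
  have hp₀le : p₀ ≤ 1 / 100 := by
    have h1 := pow_le_two_mul_factorial_mul_choose hr2 hn0
    rw [div_le_iff₀ (by positivity)] at hε
    have h2 : B * r ! ≤ k ! := by
      rw [hBdef]
      have h := Nat.choose_mul_factorial_mul_factorial hrk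
      have h' : k.choose r * r ! ≤ k ! := by
        rw [← h]
        exact Nat.le_mul_of_pos_right _ (Nat.factorial_pos _)
      exact_mod_cast h'
    have hr0 : (0 : ℝ) < r ! := by exact_mod_cast Nat.factorial_pos r
    have h3 : B ≤ ε * C := by
      refine le_of_mul_le_mul_right ?_ hr0
      nlinarith [mul_le_mul_of_nonneg_left h1 hε0.le]
    rw [hp₀, div_le_div_iff₀ (by positivity) (by norm_num)]
    linarith
  set p : unitInterval := ⟨p₀, hp₀pos.le, by linarith⟩ with hp
  -- the expected number of roots is `4`, as `e⁻⁴` leaves room below `0.05`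
  set q : unitInterval := ⟨4 / C, by positivity, (div_le_one hC0).2 h4C⟩ with hq
  refine ⟨p, q, ?_, fun β A hA => ?_⟩
  · have h := UniformHypergraph.rootedPair_real_edgeCount_le hrk (by omega : k ≤ n) p q hε0.le
    have hprob : IsProbabilityMeasure (UniformHypergraph.rootedPair n k r p q) :=
      Measure.isProbabilityMeasure_map Measurable.of_discrete.aemeasurable
    rw [probReal_compl_eq_one_sub .of_discrete] at h
    have hm : (0 : ℝ) < (n - r).choose (k - r) := by
      exact_mod_cast Nat.choose_pos (by omega)
    have hexp : ε * p * n.choose k / (n - r).choose (k - r) = 1 / 100 := by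
      have hmul : (n.choose k : ℝ) * B = C * (n - r).choose (k - r) := by
        rw [hBdef, hCdef]
        exact_mod_cast Nat.choose_mul hrk
      change ε * (B / (100 * ε * C)) * n.choose k / (n - r).choose (k - r) = 1 / 100
      rw [div_eq_iff hm.ne']
      field_simp
      linarith
    have hroot : (1 - q : ℝ) ^ n.choose r ≤ 0.02 := by
      have h1 : (1 - q : ℝ) ≤ Real.exp (-(4 / C)) := by
        have := Real.add_one_le_exp (-(4 / C))
        change 1 - 4 / C ≤ _
        linarith
      have h2 : 0 ≤ (1 - q : ℝ) := sub_nonneg.2 q.2.2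
      have h3 := pow_le_pow_left₀ h2 h1 (n.choose r)
      rw [← Real.exp_nat_mul, ← hCdef, show C * -(4 / C) = -4 by field_simp] at h3
      have h4 : Real.exp (-4) ≤ 0.02 := by
        rw [Real.exp_neg, inv_le_comm₀ (Real.exp_pos _) (by norm_num),
          show (4 : ℝ) = (4 : ℕ) * 1 by norm_num, Real.exp_nat_mul]
        have := Real.exp_one_gt_d9
        calc ((0.02 : ℝ))⁻¹ ≤ 2.7 ^ 4 := by norm_num
          _ ≤ _ := by gcongr; linarith
      exact h3.trans h4
    have hp' : (p : ℝ) ≤ 1 / 100 := hp₀le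
    rw [hexp] at h
    linarith
  · have h := UniformHypergraph.real_run_ne_le p q (powerCost α) _
      (ncard_shadow_sdiff_mul_pow_le hk1 hrk (by linarith) hαr p hp₀pos) A
    have h := hA.trans h
    set J := ∫ G, A.oracleCost (powerCost α) G.1.indOracle
      ∂(UniformHypergraph.rootedPair n k r p q)
    change 2 / 3 ≤ 4 / C * ((k : ℝ) ^ k * p₀⁻¹ ^ (((r : ℝ) - α) / k) * J) at h
    set θ : ℝ := ((r : ℝ) - α) / k with hθ
    have hθ0 : 0 ≤ θ := div_nonneg (by linarith) hk0.le
    have hθ1 : θ ≤ 1 := (div_le_one hk0).2 (by linarith)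
    have hJ : 0 ≤ J := by
      by_contra hJ
      have : 4 / C * ((k : ℝ) ^ k * p₀⁻¹ ^ θ * J) ≤ 0 :=
        mul_nonpos_of_nonneg_of_nonpos (by positivity)
          (mul_nonpos_of_nonneg_of_nonpos (by positivity) (not_le.1 hJ).le)
      linarith
    have hpinv : p₀⁻¹ ^ θ ≤ 100 * (ε ^ θ * (n : ℝ) ^ (r * θ)) := by
      have h1 : p₀⁻¹ ≤ 100 * (ε * (n : ℝ) ^ r) := by
        rw [hp₀, inv_div, div_le_iff₀ (by positivity)]
        calc 100 * ε * C ≤ 100 * ε * (n : ℝ) ^ r := by gcongr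
          _ = 100 * (ε * (n : ℝ) ^ r) * 1 := by ring
          _ ≤ _ := by gcongr
      calc p₀⁻¹ ^ θ ≤ (100 * (ε * (n : ℝ) ^ r)) ^ θ := by gcongr
        _ = 100 ^ θ * (ε ^ θ * (n : ℝ) ^ (r * θ)) := by
            rw [Real.mul_rpow (by norm_num) (by positivity), Real.mul_rpow hε0.le (by positivity),
              ← Real.rpow_natCast, ← Real.rpow_mul hn0'.le]
        _ ≤ _ := by
            gcongr
            exact Real.rpow_le_self_of_one_le (by norm_num) hθ1
    have hkk : (1 : ℝ) ≤ (k : ℝ) ^ k := one_le_pow₀ hk1'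
    have hexp : (n : ℝ) ^ ((r : ℝ) * ((k : ℝ) - r + α) / k) * (n : ℝ) ^ (r * θ) = (n : ℝ) ^ r := by
      rw [← Real.rpow_add hn0', ← Real.rpow_natCast]
      congr 1
      rw [hθ]
      field_simp
      ring
    rw [div_le_iff₀ (by positivity)]
    have hy : 0 < (n : ℝ) ^ (r * θ) := by positivity
    refine le_of_mul_le_mul_right ?_ hy
    rw [hexp]
    rw [div_mul_eq_mul_div, le_div_iff₀ hC0] at h
    calc (n : ℝ) ^ r ≤ (k : ℝ) ^ k * C := hnC
      _ ≤ (k : ℝ) ^ k * (6 * ((k : ℝ) ^ k * p₀⁻¹ ^ θ * J)) := by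
          gcongr
          linarith
      _ ≤ (k : ℝ) ^ k *
            (6 * ((k : ℝ) ^ k * (100 * (ε ^ θ * (n : ℝ) ^ (r * θ))) * J)) := by gcongr
      _ = 600 * 1 * ((k : ℝ) ^ k * (k : ℝ) ^ k * (ε ^ θ * (n : ℝ) ^ (r * θ) * J)) := by ring
      _ ≤ 1080 * (k : ℝ) ^ k * ((k : ℝ) ^ k * (k : ℝ) ^ k * (ε ^ θ * (n : ℝ) ^ (r * θ) * J)) := by
          gcongr
          norm_num
      _ = _ := by rw [mul_comm 3 k, pow_mul]; ring
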